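/- **Proposition 2.5.** Let $G$ be a finite graph (loops and multiple edges allowed) with vertex set $V$ and edges $e_1,\dots,e_m$; write $\mathfrak S_B$ for the group of permutations of a finite set $B$, and work over $\mathbb C$. *Modules.* For a nonempty finite set $B$ let $\mathrm{std}(B)\subseteq\mathbb C^B$ be the standard representation of $\mathfrak S_B$ (vectors with coordinate sum $0$) and $\mathcal L_B=\Lambda^*\mathrm{std}(B)$, a graded $\mathfrak S_B$-module. For a state $F\subseteq E(G)$ whose spanning subgraph has connected components with vertex sets $B_1,\dots,B_r$, let $$\mathcal M_F=\mathrm{Ind}_{\mathfrak S_{B_1}\times\cdots\times\mathfrak S_{B_r}}^{\mathfrak S_V}\left(\mathcal L_{B_1}\otimes\cdots\otimes\mathcal L_{B_r}\right),$$ graded by total degree. For $i,j\ge 0$ put $C_i(G)=\bigoplus_{|F|=i}\mathcal M_F$ and $C_{i,j}(G)=\bigoplus_{|F|=i}(\mathcal M_F)_j$. *Per-edge maps.* Number the blocks of every set partition of $V$ in an arbitrary way, and identify $\mathcal L_{B_1}\otimes\cdots\otimes\mathcal L_{B_r}$ with $\Lambda^*(T_F)$, $T_F=\mathrm{std}(B_1)\oplus\cdots\oplus\mathrm{std}(B_r)\subseteq\mathbb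 C^V$, by $x_1\otimes\cdots\otimes x_r\mapsto x_1\wedge\cdots\wedge x_r$. Let $e\in F$ and $F'=F-e$. If $F$ and $F'$ have the same components, then $\mathcal M_F=\mathcal M_{F'}$ and $d_\varepsilon:\mathcal M_F\to\mathcal M_{F'}$ is the identity. Otherwise one component of $F$ splits into two; let $H'\subset H$ be the Young subgroups of $\mathfrak S_V$ belonging to $F'$ and $F$. Then $T_F=T_{F'}\oplus\mathbf 1$ as $H'$-modules, where $\mathbf 1$ is the line of $H'$-invariant vectors, so $\Lambda^*(T_F)=\Lambda^*(T_{F'})\oplus\Lambda^*(T_{F'})[1]$. Let $\theta:\Lambda^*(T_F)\to\Lambda^*(T_{F'})$ be the $H'$-module map that is the identity on the first summand and zero on the second. By Frobenius reciprocity $\theta$ corresponds to an $H$-module map $\Lambda^*(T_F)\to\mathrm{Ind}_{H'}^{H}\Lambda^*(T_{F'})$, and $d_\varepsilon$ is the map that it induces, $\mathcal M_F=\mathrm{Ind}_H^{\mathfrak S_V}\Lambda^*(T_F)\to\mathrm{Ind}_H^{\mathfrak S_V}\mathrm{Ind}_{H'}^{H}\Lambda^*(T_{F'})=\mathcal M_{F'}$.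 *Differential.* Let $\mathrm{sgn}(\varepsilon)=(-1)^k$, where $k$ is the number of edges $e_l\notin F$ that come after $e$ in the list $e_1,\dots,e_m$, and for $i\ge 1$ let $d_i=\sum_\varepsilon\mathrm{sgn}(\varepsilon)\,d_\varepsilon:C_i(G)\to C_{i-1}(G)$, the sum being over all pairs $(F,e)$ with $|F|=i$ and $e\in F$ (and $d_0=0$). Then $C_i(G)=\bigoplus_{j\ge0}C_{i,j}(G)$ as $\mathfrak S_V$-modules, each $d_i$ is a homomorphism of $\mathfrak S_V$-modules with $d_i(C_{i,j}(G))\subseteq C_{i-1,j}(G)$, and $d_{i}\circ d_{i+1}=0$ for all $i\ge 0$. That is, $d$ is a differential and $(C_*(G),d)$ is a chain complex of graded $\mathfrak S_V$-modules. -/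

import Mathlib

open scoped TensorProduct DirectSum

noncomputable section

namespace ChromaticHomology

/-! ### The graded module `L_B` of a finite set `B` -/

section Standard

/-- The standard representation `S^(a-1,1)` of `Perm B`, `a = |B|`, as a subspace of the
permutation module: the vectors with coordinate sum zero. It is `0` when `|B| = 1`. -/
def std (B : Type*) [Fintype B] : Submodule ℂ (B → ℂ) where
  carrier := {x | ∑ b, x b = 0}
  add_mem' := by
    intro x y hx hy
    simp only [Set.mem_ofPred_eq, Pi.add_apply, Finset.sum_add_distrib] at *
    rw [hx, hy, add_zero]
  zero_mem' := by simp
  smul_mem' := by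
    intro c x hx
    simp only [Set.mem_ofPred_eq, Pi.smul_apply, ← Finset.smul_sum] at *
    rw [hx, smul_zero]

/-- The action of `Perm B` on the standard representation, `(σ x) b = x (σ⁻¹ b)`. -/
def stdRep (B : Type*) [Fintype B] : Representation ℂ (Equiv.Perm B) (std B) where
  toFun σ := (LinearMap.funLeft ℂ ℂ (σ⁻¹ : Equiv.Perm B)).restrict (p := std B) (q := std B) <| by
    intro x hx
    change ∑ b, x (σ⁻¹ b) = 0
    rw [Equiv.sum_comp]
    exact hx
  map_one' := rfl
  map_mul' σ τ := by
    ext x b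
    simp [LinearMap.funLeft_apply]

/-- `L_B = Λ^*(std B)`; its degree `i` part `Λ^i S^(a-1,1) = S^(a-i,1^i)` is `⋀[ℂ]^i (std B)`.
For `|B| = 1` this is the trivial module in degree `0`. -/
abbrev L (B : Type*) [Fintype B] : Type _ := ExteriorAlgebra ℂ (std B)

/-- The action of `Perm B` on `L_B` (by algebra automorphisms). -/
def LRep (B : Type*) [Fintype B] : Representation ℂ (Equiv.Perm B) (L B) where
  toFun σ := (ExteriorAlgebra.map (stdRep B σ)).toLinearMap
  map_one' := by
    rw [map_one]
    exact congrArg AlgHom.toLinearMap ExteriorAlgebra.map_id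
  map_mul' σ τ := by
    rw [map_mul]
    exact congrArg AlgHom.toLinearMap
      (ExteriorAlgebra.map_comp_map (stdRep B τ) (stdRep B σ)).symm

end Standard

/-! ### Set partitions, Young subgroups, and the tensor product of the `L_B` -/

section Partition

variable {V : Type*} [Fintype V]

/-- A block of the set partition of `V` given by `π`, as a type. -/
def Block (π : Setoid V) (q : Quotient π) : Type _ := {v : V // Quotient.mk π v = q}

instance (π : Setoid V) (q : Quotient π) : Finite (Block π q) :=
  inferInstanceAs (Finite {v : V // Quotient.mk π v = q})

instance (π : Setoid V) (q : Quotient π) : Fintype (Block π q) := Fintype.ofFinite _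

/-- The Young subgroup `S_{B_1} × ⋯ × S_{B_r}` of `Perm V`: the permutations that preserve each
block of `π`. -/
def young (π : Setoid V) : Subgroup (Equiv.Perm V) where
  carrier := {σ | ∀ v, Quotient.mk π (σ v) = Quotient.mk π v}
  mul_mem' := by
    intro σ τ hσ hτ v
    rw [Equiv.Perm.mul_apply, hσ, hτ]
  one_mem' := fun _ => rfl
  inv_mem' := by
    intro σ hσ v
    have h := hσ (σ⁻¹ v)
    rw [show σ (σ⁻¹ v) = v from σ.apply_symm_apply v] at h
    exact h.symm

/-- The component in `S_B` of an element of the Young subgroup. -/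
def blockPerm (π : Setoid V) (q : Quotient π) : young π →* Equiv.Perm (Block π q) where
  toFun σ := σ.1.subtypePerm (p := fun v => Quotient.mk π v = q) fun v => by rw [σ.2 v]
  map_one' := rfl
  map_mul' _ _ := rfl

/-- The tensor product `L_{B_1} ⊗ ⋯ ⊗ L_{B_r}` over the blocks of `π`. -/
abbrev W (π : Setoid V) : Type _ := ⨂[ℂ] q : Quotient π, L (Block π q)

/-- The action of the Young subgroup on `L_{B_1} ⊗ ⋯ ⊗ L_{B_r}`. -/
def WRep (π : Setoid V) : Representation ℂ (young π) (W π) where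
  toFun σ := PiTensorProduct.map fun q => LRep (Block π q) (blockPerm π q σ)
  map_one' := by
    simp only [map_one]
    exact PiTensorProduct.map_one
  map_mul' σ τ := by
    simp only [map_mul]
    exact PiTensorProduct.map_mul _ _

/-- The degree `j` part of `L_{B_1} ⊗ ⋯ ⊗ L_{B_r}`. -/
def WGr (π : Setoid V) (j : ℕ) : Submodule ℂ (W π) :=
  Submodule.span ℂ {t | ∃ (k : Quotient π → ℕ) (x : ∀ q, L (Block π q)),
    (∀ q, x q ∈ ⋀[ℂ]^(k q) (std (Block π q))) ∧ ∑ᶠ q, k q = j ∧ t = PiTensorProduct.tprod ℂ x}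

/-- The module `Ind (L_{B_1} ⊗ ⋯ ⊗ L_{B_r})` induced from the Young subgroup to `Perm V`: the
functions `f : Perm V → L_{B_1} ⊗ ⋯ ⊗ L_{B_r}` with `f (h g) = h f(g)` for `h` in the Young
subgroup. (This is the function model of the induced module of a finite group; it is isomorphic to
the model by coinvariants through `Rep.indCoindIso`.) -/
abbrev M (π : Setoid V) : Type _ := Representation.coindV (young π).subtype (WRep π)

/-- The action of `Perm V` on the induced module, by right translation. -/
abbrev MRep (π : Setoid V) : Representation ℂ (Equiv.Perm V) (M π) :=
  Representation.coind (young π).subtype (WRep π)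

/-- The degree `j` part of the induced module. -/
def MGr (π : Setoid V) (j : ℕ) : Submodule ℂ (M π) where
  carrier := {f | ∀ g, f.1 g ∈ WGr π j}
  add_mem' hx hy g := (WGr π j).add_mem (hx g) (hy g)
  zero_mem' _ := (WGr π j).zero_mem
  smul_mem' c _ hx g := (WGr π j).smul_mem c (hx g)

end Partition

/-! ### `L_{B_1} ⊗ ⋯ ⊗ L_{B_r} = Λ^*(T)` with `T = std B_1 ⊕ ⋯ ⊕ std B_r` -/

section Exterior

variable {V : Type*} [Fintype V]

/-- The (internal) direct sum `T` of the standard representations of the blocks of `π`: the vectors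
in `ℂ^V` whose coordinates sum to zero on every block. -/
def T (π : Setoid V) : Submodule ℂ (V → ℂ) where
  carrier := {x | ∀ q, ∑ v : Block π q, x v.1 = 0}
  add_mem' := by
    intro x y hx hy q
    simp only [Pi.add_apply, Finset.sum_add_distrib, hx q, hy q, add_zero]
  zero_mem' := by simp
  smul_mem' := by
    intro c x hx q
    simp only [Pi.smul_apply, ← Finset.smul_sum, hx q, smul_zero]

open Classical in
/-- The inclusion of the summand `std B` into `T`, extension by zero. -/
def incl (π : Setoid V) (q : Quotient π) : std (Block π q) →ₗ[ℂ] T π where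
  toFun x := ⟨fun v => if h : Quotient.mk π v = q then x.1 ⟨v, h⟩ else 0, by
    intro q'
    by_cases hq : q' = q
    · subst hq
      rw [← show ∑ b, x.1 b = 0 from x.2]
      exact Finset.sum_congr rfl fun v _ => dif_pos v.2
    · exact Finset.sum_eq_zero fun v _ => dif_neg fun h => hq (v.2.symm.trans h)⟩
  map_add' x y := by
    ext v
    by_cases h : Quotient.mk π v = q <;> (simp [h]; try rfl)
  map_smul' c x := by
    ext v
    by_cases h : Quotient.mk π v = q <;> (simp [h]; try rfl)

/-- A numbering `B_1, …, B_r` of the blocks of every set partition of `V`. -/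
abbrev BlockNumbering (V : Type*) : Type _ :=
  ∀ π : Setoid V, Fin (Nat.card (Quotient π)) ≃ Quotient π

/-- The multiplication map `L_{B_1} ⊗ ⋯ ⊗ L_{B_r} → Λ^*(T)`,
`x_1 ⊗ ⋯ ⊗ x_r ↦ x_1 ∧ ⋯ ∧ x_r`. -/
def wedge (num : BlockNumbering V) (π : Setoid V) : W π →ₗ[ℂ] ExteriorAlgebra ℂ (T π) :=
  PiTensorProduct.lift <|
    ((MultilinearMap.mkPiAlgebraFin ℂ (Nat.card (Quotient π))
      (ExteriorAlgebra ℂ (T π))).domDomCongr (num π)).compLinearMap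
        fun q => (ExteriorAlgebra.map (incl π q)).toLinearMap

theorem wedge_tprod (num : BlockNumbering V) (π : Setoid V) (x : ∀ q, L (Block π q)) :
    wedge num π (PiTensorProduct.tprod ℂ x) =
      (List.ofFn fun i => ExteriorAlgebra.map (incl π (num π i)) (x (num π i))).prod := by
  simp [wedge]

theorem incl_apply (π : Setoid V) (q : Quotient π) (x : std (Block π q)) (v : V)
    (h : Quotient.mk π v = q) : (incl π q x).1 v = x.1 ⟨v, h⟩ := by
  simp only [incl, LinearMap.coe_mk, AddHom.coe_mk]
  exact dif_pos h

theorem incl_apply_of_ne (π : Setoid V) (q : Quotient π) (x : std (Block π q)) (v : V)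
    (h : Quotient.mk π v ≠ q) : (incl π q x).1 v = 0 := by
  simp only [incl, LinearMap.coe_mk, AddHom.coe_mk]
  exact dif_neg h

/-- `T` is the direct sum of the `std B`. -/
def TEquiv (π : Setoid V) : T π ≃ₗ[ℂ] (∀ q, std (Block π q)) where
  toFun t q := ⟨fun v => t.1 v.1, t.2 q⟩
  map_add' _ _ := rfl
  map_smul' _ _ := rfl
  invFun x := ⟨fun v => (x (Quotient.mk π v)).1 ⟨v, rfl⟩, fun q => by
    rw [← show ∑ b, (x q).1 b = 0 from (x q).2]
    refine Finset.sum_congr rfl fun v _ => ?_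
    obtain ⟨v, rfl⟩ := v
    rfl⟩
  left_inv _ := rfl
  right_inv x := by
    funext q
    ext ⟨v, rfl⟩
    rfl

theorem exists_eq_sum_incl (π : Setoid V) [Fintype (Quotient π)] (t : T π) :
    t = ∑ q, incl π q (TEquiv π t q) := by
  ext v
  rw [AddSubmonoidClass.coe_finsetSum, Finset.sum_apply,
    Finset.sum_eq_single (Quotient.mk π v)]
  · rw [incl_apply π _ _ v rfl]
    rfl
  · intro q _ hq
    exact incl_apply_of_ne π q _ v (Ne.symm hq)
  · simp

theorem ι_mul_map {A B : Type*} [AddCommGroup A] [Module ℂ A] [AddCommGroup B] [Module ℂ B]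
    (f : A →ₗ[ℂ] B) (y : B) (x : ExteriorAlgebra ℂ A) :
    ExteriorAlgebra.ι ℂ y * ExteriorAlgebra.map f x =
      ExteriorAlgebra.map f (ExteriorAlgebra.map (-LinearMap.id) x) * ExteriorAlgebra.ι ℂ y := by
  induction x using ExteriorAlgebra.induction with
  | algebraMap r => simp only [AlgHom.commutes, Algebra.commutes]
  | ι m =>
    simp only [ExteriorAlgebra.map_apply_ι, LinearMap.neg_apply, LinearMap.id_apply, map_neg,
      neg_mul]
    exact eq_neg_of_add_eq_zero_left (ExteriorAlgebra.ι_add_mul_swap _ _)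
  | mul a b ha hb => rw [map_mul, ← mul_assoc, ha, mul_assoc, hb, map_mul, map_mul, mul_assoc]
  | add a b ha hb => simp only [map_add, mul_add, add_mul, ha, hb]

theorem mul_prod_ofFn {A : Type*} [Monoid A] (y : A) :
    ∀ (n : ℕ) (X X' : Fin n → A) (_ : ∀ i, y * X i = X' i * y) (j : Fin n),
      y * (List.ofFn X).prod =
        (List.ofFn fun i => if i < j then X' i else if i = j then y * X i else X i).prod
  | 0, _, _, _, j => j.elim0
  | n + 1, X, X', h, j => by
    rw [List.ofFn_succ, List.ofFn_succ, List.prod_cons, List.prod_cons, ← mul_assoc]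
    induction j using Fin.cases with
    | zero => simp [Fin.succ_ne_zero]
    | succ j =>
      have ih := mul_prod_ofFn y n (fun i => X i.succ) (fun i => X' i.succ) (fun i => h _) j
      rw [h, mul_assoc, ih]
      simp [Fin.succ_pos]

theorem wedge_surjective (num : BlockNumbering V) (π : Setoid V) :
    Function.Surjective (wedge num π) := by
  classical
  have : Fintype (Quotient π) := Fintype.ofFinite _
  have key : ∀ (q : Quotient π) (s : std (Block π q)) (w : W π),
      ExteriorAlgebra.ι ℂ (incl π q s) * wedge num π w ∈ LinearMap.range (wedge num π) := by
    intro q s w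
    induction w using PiTensorProduct.induction_on with
    | smul_tprod r x =>
      rw [map_smul, mul_smul_comm]
      refine Submodule.smul_mem _ _ ?_
      obtain ⟨j, rfl⟩ := (num π).surjective q
      refine ⟨PiTensorProduct.tprod ℂ fun q' =>
        if (num π).symm q' < j then ExteriorAlgebra.map (-LinearMap.id) (x q')
        else if h : num π j = q' then ExteriorAlgebra.ι ℂ (h ▸ s) * x q' else x q', ?_⟩
      rw [wedge_tprod, wedge_tprod,
        mul_prod_ofFn _ _ _ (fun i => ExteriorAlgebra.map (incl π (num π i))
          (ExteriorAlgebra.map (-LinearMap.id) (x (num π i)))) (fun i => ι_mul_map _ _ _) j]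
      congr 2
      funext i
      rw [Equiv.symm_apply_apply]
      by_cases h1 : i < j
      · simp [h1]
      · by_cases h2 : i = j
        · subst h2
          simp
        · have h3 : ¬ num π j = num π i := fun h => h2 ((num π).injective h).symm
          simp [h1, h2, h3]
    | add a b ha hb =>
      rw [map_add, mul_add]
      exact Submodule.add_mem _ ha hb
  have key2 : ∀ a b : ExteriorAlgebra ℂ (T π), b ∈ LinearMap.range (wedge num π) →
      a * b ∈ LinearMap.range (wedge num π) := by
    intro a
    induction a using ExteriorAlgebra.induction with
    | algebraMap r =>
      intro b hb
      rw [← Algebra.smul_def]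
      exact Submodule.smul_mem _ _ hb
    | ι t =>
      rintro _ ⟨w, rfl⟩
      rw [exists_eq_sum_incl π t, map_sum, Finset.sum_mul]
      exact Submodule.sum_mem _ fun q _ => key q _ w
    | mul a b ha hb =>
      intro c hc
      rw [mul_assoc]
      exact ha _ (hb _ hc)
    | add a b ha hb =>
      intro c hc
      rw [add_mul]
      exact Submodule.add_mem _ (ha _ hc) (hb _ hc)
  intro a
  have h1 : (1 : ExteriorAlgebra ℂ (T π)) ∈ LinearMap.range (wedge num π) :=
    ⟨PiTensorProduct.tprod ℂ fun _ => 1, by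
      rw [wedge_tprod]
      exact List.prod_eq_one (by simp)⟩
  have := key2 a 1 h1
  rwa [mul_one] at this

theorem wedge_bijective (num : BlockNumbering V) (π : Setoid V) :
    Function.Bijective (wedge num π) := by
  classical
  have : Fintype (Quotient π) := Fintype.ofFinite _
  have bT := (Module.finBasis ℂ (T π)).ExteriorAlgebra
  have bq := fun q : Quotient π => (Module.finBasis ℂ (std (Block π q))).ExteriorAlgebra
  have bW := Basis.piTensorProduct bq
  have := Module.Basis.finiteDimensional_of_finite bT
  have := Module.Basis.finiteDimensional_of_finite bW
  have h1 : Module.finrank ℂ (W π) = Module.finrank ℂ (ExteriorAlgebra ℂ (T π)) := by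
    rw [Module.finrank_eq_card_basis bW, Module.finrank_eq_card_basis bT,
      Fintype.card_pi, Fintype.card_finset, Fintype.card_fin, (TEquiv π).finrank_eq,
      Module.finrank_pi_fintype, ← Finset.prod_pow_eq_pow_sum]
    simp
  exact ⟨(LinearMap.injective_iff_surjective_of_finrank_eq_finrank h1).2
    (wedge_surjective num π), wedge_surjective num π⟩

/-- The identification `L_{B_1} ⊗ ⋯ ⊗ L_{B_r} = Λ^*(T)` by multiplication. -/
def wedgeEquiv (num : BlockNumbering V) (π : Setoid V) : W π ≃ₗ[ℂ] ExteriorAlgebra ℂ (T π) :=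
  LinearEquiv.ofBijective (wedge num π) (wedge_bijective num π)

/-- The action of the Young subgroup on `T` by permutation of coordinates. -/
def TRep (π : Setoid V) : Representation ℂ (young π) (T π) where
  toFun σ := (LinearMap.funLeft ℂ ℂ (σ.1⁻¹ : Equiv.Perm V)).restrict (p := T π) (q := T π) <| by
    intro x hx q
    change ∑ v : Block π q, x ((blockPerm π q σ)⁻¹ v).1 = 0
    rw [Equiv.sum_comp (blockPerm π q σ)⁻¹ fun v : Block π q => x v.1]
    exact hx q
  map_one' := rfl
  map_mul' σ τ := by
    ext x b
    simp [LinearMap.funLeft_apply]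

theorem TRep_incl (π : Setoid V) (q : Quotient π) (σ : young π) (x : std (Block π q)) :
    TRep π σ (incl π q x) = incl π q (stdRep _ (blockPerm π q σ) x) := by
  ext v
  change (incl π q x).1 (σ.1⁻¹ v) = _
  have hv : Quotient.mk π (σ.1⁻¹ v) = Quotient.mk π v := (σ⁻¹).2 v
  by_cases h : Quotient.mk π v = q
  · rw [incl_apply π q _ v h, incl_apply π q x _ (hv.trans h)]
    rfl
  · rw [incl_apply_of_ne π q _ v h, incl_apply_of_ne π q x _ (fun h' => h (hv.symm.trans h'))]

theorem wedge_WRep (num : BlockNumbering V) (π : Setoid V) (σ : young π) (w : W π) :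
    wedge num π (WRep π σ w) = ExteriorAlgebra.map (TRep π σ) (wedge num π w) := by
  induction w using PiTensorProduct.induction_on with
  | smul_tprod r x =>
    simp only [map_smul]
    congr 1
    change wedge num π (PiTensorProduct.map _ _) = _
    rw [PiTensorProduct.map_tprod, wedge_tprod, wedge_tprod, map_list_prod, List.map_ofFn]
    congr 2
    funext i
    change (ExteriorAlgebra.map _) ((ExteriorAlgebra.map _) _) =
      (ExteriorAlgebra.map _) ((ExteriorAlgebra.map _) _)
    rw [← AlgHom.comp_apply, ← AlgHom.comp_apply, ExteriorAlgebra.map_comp_map,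
      ExteriorAlgebra.map_comp_map]
    congr 2
    ext1 y
    exact (TRep_incl π _ σ y).symm
  | add a b ha hb => simp only [map_add, ha, hb]

end Exterior

/-! ### The projection onto `T` -/

section Projection

variable {V : Type*} [Fintype V]

/-- The vectors that are constant on each block of `π`: the invariants of the Young subgroup in
the permutation module `ℂ^V`. -/
def invariants (π : Setoid V) : Submodule ℂ (V → ℂ) where
  carrier := {x | ∀ u v, π u v → x u = x v}
  add_mem' hx hy u v h := by rw [Pi.add_apply, Pi.add_apply, hx u v h, hy u v h]
  zero_mem' _ _ _ := rfl
  smul_mem' c x hx u v h := by rw [Pi.smul_apply, Pi.smul_apply, hx u v h]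

theorem isCompl_T_invariants (π : Setoid V) : IsCompl (T π) (invariants π) := by
  have hcard : ∀ q : Quotient π, (Fintype.card (Block π q) : ℂ) ≠ 0 := by
    intro q
    obtain ⟨v, hv⟩ := Quotient.exists_rep q
    have : Nonempty (Block π q) := ⟨⟨v, hv⟩⟩
    exact Nat.cast_ne_zero.2 Fintype.card_ne_zero
  constructor
  · rw [Submodule.disjoint_def]
    intro x hT hK
    funext v
    have h := hT (Quotient.mk π v)
    rw [Finset.sum_congr rfl fun (u : Block π (Quotient.mk π v)) _ =>
      hK u.1 v (Quotient.exact u.2), Finset.sum_const, Finset.card_univ, nsmul_eq_mul] at h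
    exact (mul_eq_zero.1 h).resolve_left (hcard _)
  · rw [codisjoint_iff, eq_top_iff]
    intro x _
    let a : Quotient π → ℂ := fun q => (∑ u : Block π q, x u.1) / Fintype.card (Block π q)
    rw [Submodule.mem_sup]
    refine ⟨fun v => x v - a (Quotient.mk π v), ?_, fun v => a (Quotient.mk π v), ?_, ?_⟩
    · intro q
      rw [Finset.sum_sub_distrib, Finset.sum_congr rfl fun (u : Block π q) _ =>
        show a (Quotient.mk π u.1) = a q by rw [u.2], Finset.sum_const, Finset.card_univ,
        nsmul_eq_mul, mul_div_cancel₀ _ (hcard q), sub_self]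
    · intro u v h
      change a _ = a _
      rw [Quotient.sound h]
    · funext v
      exact sub_add_cancel _ _

/-- For `π'` finer than `π`, the map `T_π → T_π'` which is the identity on the summand `T_π'` of
`T_π` and zero on its complement, the invariants of the Young subgroup of `π'`. If `π'` arises from
`π` by splitting one block in two, this complement is the trivial representation in
`T_π = T_π' ⊕ 1`, and the map is the identity on `std B` for all other blocks `B` of `π`. -/
def proj (π π' : Setoid V) : T π →ₗ[ℂ] T π' :=
  (T π').projectionOnto (invariants π') (isCompl_T_invariants π') ∘ₗ (T π).subtype

theorem young_mono {V : Type*} {π π' : Setoid V} (h : π' ≤ π) : young π' ≤ young π :=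
  fun _ hσ v => Quotient.sound (h (Quotient.exact (hσ v)))

theorem proj_TRep {π π' : Setoid V} (h : π' ≤ π) (σ : young π') (x : T π) :
    proj π π' (TRep π (Subgroup.inclusion (young_mono h) σ) x) = TRep π' σ (proj π π' x) := by
  have hc := isCompl_T_invariants π'
  set t := proj π π' x with ht
  have hK : x.1 - t.1 ∈ invariants π' := by
    rw [← Submodule.projectionOnto_apply_eq_zero_iff hc, map_sub, sub_eq_zero,
      Submodule.projectionOnto_apply_left hc t]
    rfl
  change (T π').projectionOnto (invariants π') hc
    (TRep π (Subgroup.inclusion (young_mono h) σ) x).1 = _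
  rw [← Submodule.projectionOnto_apply_left hc (TRep π' σ t), ← sub_eq_zero, ← map_sub,
    Submodule.projectionOnto_apply_eq_zero_iff]
  intro u v huv
  exact hK _ _ (Quotient.exact (((σ⁻¹).2 u).trans ((Quotient.sound huv).trans
    ((σ⁻¹).2 v).symm)))

/-- The map of modules over the Young subgroup of `π'`, from `L_{B_1} ⊗ ⋯ ⊗ L_{B_r} = Λ^*(T_π)`
(blocks of `π`) to `L_{B'_1} ⊗ ⋯ ⊗ L_{B'_s} = Λ^*(T_π')` (blocks of `π'`). If `π'` arises from `π`
by splitting one block in two, then `Λ^*(T_π) = Λ^*(T_π') ⊕ Λ^*(T_π')[1]`, and this is the identity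
on the first summand and zero on the second. -/
def splitMap (num : BlockNumbering V) {π π' : Setoid V} (h : π' ≤ π) :
    Representation.IntertwiningMap
      ((WRep π).comp (Subgroup.inclusion (young_mono h))) (WRep π') where
  toLinearMap := (wedgeEquiv num π').symm.toLinearMap ∘ₗ
    (ExteriorAlgebra.map (proj π π')).toLinearMap ∘ₗ (wedgeEquiv num π).toLinearMap
  isIntertwining' σ := by
    ext1
    ext x
    change (wedgeEquiv num π').symm (ExteriorAlgebra.map (proj π π') (wedge num π (WRep π
      (Subgroup.inclusion (young_mono h) σ) (PiTensorProduct.tprod ℂ x)))) = WRep π' σ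
      ((wedgeEquiv num π').symm (ExteriorAlgebra.map (proj π π') (wedge num π _)))
    rw [LinearEquiv.symm_apply_eq]
    change _ = wedge num π' _
    rw [wedge_WRep, wedge_WRep]
    change _ = ExteriorAlgebra.map (TRep π' σ) (wedgeEquiv num π' _)
    rw [LinearEquiv.apply_symm_apply, ← AlgHom.comp_apply, ← AlgHom.comp_apply,
      ExteriorAlgebra.map_comp_map, ExteriorAlgebra.map_comp_map]
    congr 2
    ext1 y
    exact proj_TRep h σ y

end Projection

/-! ### Frobenius reciprocity and transitivity of induction -/

section Induction

variable {G : Type*} [Group G] {H K : Subgroup G} (hKH : K ≤ H) {A B : Type*}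
  [AddCommGroup A] [Module ℂ A] [AddCommGroup B] [Module ℂ B]
  {ρ : Representation ℂ H A} {τ : Representation ℂ K B}

/-- Frobenius reciprocity: the `H`-map `A → Ind_K^H B` that corresponds to a `K`-map
`θ : Res A → B`, namely `a ↦ (h ↦ θ (h a))`. -/
def frobenius (θ : Representation.IntertwiningMap (ρ.comp (Subgroup.inclusion hKH)) τ) :
    Representation.IntertwiningMap ρ (Representation.coind (Subgroup.inclusion hKH) τ) where
  toLinearMap :=
    { toFun := fun a => ⟨fun h => θ (ρ h a), fun k h => by
        change θ (ρ (Subgroup.inclusion hKH k * h) a) = τ k (θ (ρ h a))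
        rw [map_mul]
        exact Representation.IntertwiningMap.isIntertwining _ _ θ k _⟩
      map_add' := fun a b => by
        ext h
        simp
      map_smul' := fun c a => by
        ext h
        simp }
  isIntertwining' h := by
    ext a h'
    change θ (ρ h' (ρ h a)) = θ (ρ (h' * h) a)
    rw [map_mul]
    rfl

/-- Transitivity of induction, `Ind_H^G (Ind_K^H B) → Ind_K^G B`, `f ↦ (g ↦ f(g)(1))`. -/
def indTrans (τ : Representation ℂ K B) :
    Representation.IntertwiningMap
      (Representation.coind H.subtype (Representation.coind (Subgroup.inclusion hKH) τ))
      (Representation.coind K.subtype τ) where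
  toLinearMap :=
    { toFun := fun f => ⟨fun g => (f.1 g).1 1, fun k g => by
        have h1 := f.2 (Subgroup.inclusion hKH k) g
        have h2 := (f.1 g).2 k 1
        rw [mul_one] at h2
        rw [← h2]
        change (f.1 (H.subtype (Subgroup.inclusion hKH k) * g)).1 1 = _
        rw [h1]
        change (f.1 g).1 (1 * Subgroup.inclusion hKH k) = _
        rw [one_mul]⟩
      map_add' := fun _ _ => rfl
      map_smul' := fun _ _ => rfl }
  isIntertwining' _ := rfl

end Induction

/-! ### The chain complex of a graph -/

section Graph

variable {V : Type*} [Fintype V] {m : ℕ}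

/-- The partition of the vertex set into the connected components of the spanning subgraph with
edge set `F`. The multigraph has vertex set `V` and edges `e_0, …, e_{m-1}`, where `e_i` joins the
two elements of `ends i` (loops and multiple edges are allowed). -/
def components (ends : Fin m → Sym2 V) (F : Finset (Fin m)) : Setoid V :=
  (SimpleGraph.fromEdgeSet (ends '' (F : Set (Fin m)))).reachableSetoid

theorem components_mono {V : Type*} (ends : Fin m → Sym2 V) {F F' : Finset (Fin m)} (h : F' ⊆ F) :
    components ends F' ≤ components ends F := by
  intro u v huv
  exact SimpleGraph.Reachable.mono
    (SimpleGraph.fromEdgeSet_mono (Set.image_mono (Finset.coe_subset.2 h))) huv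

open Classical in
/-- The map `M_π → M_π'` for a partition `π'` finer than `π`: the identity if `π' = π`, and
otherwise the map `Ind_H^G (L_{B_1} ⊗ ⋯ ⊗ L_{B_r}) → Ind_H^G Ind_K^H (L_{B'_1} ⊗ ⋯ ⊗ L_{B'_s})`
induced from the Frobenius correspondent of `splitMap`, where `G`, `H`, `K` are `Perm V` and the
Young subgroups of `π`, `π'`. -/
def inducedMap (num : BlockNumbering V) {π π' : Setoid V} (h : π' ≤ π) : M π →ₗ[ℂ] M π' :=
  if hπ : π = π' then hπ ▸ LinearMap.id
  else (indTrans (young_mono h) (WRep π')).toLinearMap ∘ₗ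
    (Representation.coindMap (young π).subtype
      (frobenius (young_mono h) (splitMap num h))).toLinearMap

/-- The per-edge map `d_ε : M_F → M_{F-e}`. -/
def perEdge (num : BlockNumbering V) (ends : Fin m → Sym2 V) (F : Finset (Fin m)) (e : Fin m) :
    M (components ends F) →ₗ[ℂ] M (components ends (F.erase e)) :=
  inducedMap num (components_mono ends (F.erase_subset e))

/-- The sign `(-1)^k` of the edge `F → F - e` of the Hasse diagram, where `k` is the number of
missing edges after `e`. -/
def sgn (F : Finset (Fin m)) (e : Fin m) : ℂ :=
  (-1) ^ (Finset.univ.filter fun e' => e < e' ∧ e' ∉ F).card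

/-- The states with `i` edges. -/
abbrev State (m i : ℕ) : Type := {F : Finset (Fin m) // F.card = i}

/-- The state `F - e`. -/
def State.erase {i : ℕ} (F : State m (i + 1)) (e : {e // e ∈ F.1}) : State m i :=
  ⟨F.1.erase e.1, by rw [Finset.card_erase_of_mem e.2, F.2, Nat.add_sub_cancel]⟩

/-- The chain module `C_i = ⨁_{|F| = i} M_F`. -/
abbrev C (ends : Fin m → Sym2 V) (i : ℕ) : Type _ :=
  ⨁ F : State m i, M (components ends F.1)

/-- The action of `Perm V` on `C_i`. -/
abbrev CRep (ends : Fin m → Sym2 V) (i : ℕ) : Representation ℂ (Equiv.Perm V) (C ends i) :=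
  Representation.directSum fun F : State m i => MRep (components ends F.1)

/-- The graded piece `C_{i,j} = ⨁_{|F| = i} (M_F)_j` of `C_i`. -/
def CGr (ends : Fin m → Sym2 V) (i j : ℕ) : Submodule ℂ (C ends i) where
  carrier := {x | ∀ F, x F ∈ MGr (components ends F.1) j}
  add_mem' hx hy F := (MGr _ j).add_mem (hx F) (hy F)
  zero_mem' _ := (MGr _ j).zero_mem
  smul_mem' c _ hx F := (MGr _ j).smul_mem c (hx F)

/-- The map `d_{i+1} : C_{i+1} → C_i`, the sum of the signed per-edge maps. (There is also the zero
map `d_0 : C_0 → C_{-1} = 0`.) -/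
def d (num : BlockNumbering V) (ends : Fin m → Sym2 V) (i : ℕ) : C ends (i + 1) →ₗ[ℂ] C ends i :=
  DirectSum.toModule ℂ _ _ fun F : State m (i + 1) =>
    ∑ e : {e // e ∈ F.1},
      DirectSum.lof ℂ (State m i) (fun F' => M (components ends F'.1)) (F.erase e) ∘ₗ
        (sgn F.1 e.1 • perEdge num ends F.1 e.1)

end Graph

end ChromaticHomology

end

open scoped TensorProduct DirectSum

noncomputable section

namespace ChromaticHomology

/-! ### Degrees in an exterior algebra. -/

section ExteriorGrading

variable {A B : Type*} [AddCommGroup A] [Module ℂ A] [AddCommGroup B] [Module ℂ B]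

/-! Everything reduces to linear algebra on the spaces `T π`. On functions `Perm V → W π` the
per-edge map acts value by value through `splitMap` (`inducedMap_apply`), and under `wedge` the
latter is `Λ^*` of the projection `proj`. The identity case needs no separate treatment, since `proj
π π` is the identity. Acting on values, the per-edge maps commute with right translation, which
gives equivariance; being induced by linear maps of the `T π`, they preserve degree.

A finer partition has more block-constant vectors, so the kernels of the projections grow under
refinement and the projections compose (`proj_proj`). Hence removing two edges gives the same map in
either order (`inducedMap_inducedMap`), while the two products of signs are opposite
(`sgn_mul_sgn_erase`). Swapping the two edges cancels the terms of `d ∘ d` in pairs.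

For the grading, `mem_WGr_iff` identifies the degree `j` part of the tensor product with `⋀^j T`.
The degree projections of `Λ^*(T)` then pass to `W`, to `M` and to `C`, and they exhibit the direct
sum (`isInternal_of_projections`). -/

theorem map_mem_exteriorPower (f : A →ₗ[ℂ] B) {j : ℕ} {x : ExteriorAlgebra ℂ A}
    (hx : x ∈ ⋀[ℂ]^j A) : ExteriorAlgebra.map f x ∈ ⋀[ℂ]^j B := by
  have h : Submodule.map (ExteriorAlgebra.map f).toLinearMap (⋀[ℂ]^j A) ≤ ⋀[ℂ]^j B := by
    -- `⋀^j` is the `j`-th power of the range of `ι`, so only degree one has to be checked.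
    refine (Submodule.map_pow _ _ _).trans_le (pow_le_pow_left' ?_ j)
    rintro _ ⟨_, ⟨a, rfl⟩, rfl⟩
    exact ⟨f a, (ExteriorAlgebra.map_apply_ι f a).symm⟩
  exact h ⟨x, hx, rfl⟩

/-- The projection of `Λ^*(A)` onto its degree `j` part. -/
def degreeProj (A : Type*) [AddCommGroup A] [Module ℂ A] (j : ℕ) :
    ExteriorAlgebra ℂ A →ₗ[ℂ] ExteriorAlgebra ℂ A :=
  GradedAlgebra.proj (fun i : ℕ => ⋀[ℂ]^i A) j

theorem degreeProj_mem (j : ℕ) (x : ExteriorAlgebra ℂ A) : degreeProj A j x ∈ ⋀[ℂ]^j A :=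
  SetLike.coe_mem (DirectSum.decompose (fun i : ℕ => ⋀[ℂ]^i A) x j)

theorem degreeProj_of_mem {j : ℕ} {x : ExteriorAlgebra ℂ A} (hx : x ∈ ⋀[ℂ]^j A) :
    degreeProj A j x = x :=
  DirectSum.decompose_of_mem_same (fun i : ℕ => ⋀[ℂ]^i A) hx

theorem degreeProj_of_mem_ne {j k : ℕ} {x : ExteriorAlgebra ℂ A} (hx : x ∈ ⋀[ℂ]^k A)
    (h : k ≠ j) : degreeProj A j x = 0 :=
  DirectSum.decompose_of_mem_ne (fun i : ℕ => ⋀[ℂ]^i A) hx h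

/-- Allowing every larger `t` lets finitely many elements share one index set, namely the union of
their supports. -/
theorem exists_sum_degreeProj (x : ExteriorAlgebra ℂ A) :
    ∃ s : Finset ℕ, ∀ t, s ⊆ t → ∑ j ∈ t, degreeProj A j x = x := by
  classical
  refine ⟨(DirectSum.decompose (fun i : ℕ => ⋀[ℂ]^i A) x).support, fun t ht => ?_⟩
  conv_rhs => rw [← DirectSum.sum_support_decompose (fun i : ℕ => ⋀[ℂ]^i A) x]
  refine (Finset.sum_subset ht fun j _ hj => ?_).symm
  change ((DirectSum.decompose (fun i : ℕ => ⋀[ℂ]^i A) x j : ⋀[ℂ]^j A) : ExteriorAlgebra ℂ A) = 0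
  rw [DFinsupp.notMem_support_iff.1 hj]
  rfl

/-- An induced map sends homogeneous components to homogeneous components of the same degree. This
makes the degree projections equivariant. -/
theorem degreeProj_map (f : A →ₗ[ℂ] B) (j : ℕ) (x : ExteriorAlgebra ℂ A) :
    degreeProj B j (ExteriorAlgebra.map f x) = ExteriorAlgebra.map f (degreeProj A j x) := by
  obtain ⟨s, hs⟩ := exists_sum_degreeProj x
  rw [← hs s subset_rfl]
  simp only [map_sum]
  refine Finset.sum_congr rfl fun k _ => ?_
  have hk := degreeProj_mem k x
  by_cases h : k = j
  · subst h
    rw [degreeProj_of_mem hk, degreeProj_of_mem (map_mem_exteriorPower f hk)]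
  · rw [degreeProj_of_mem_ne hk h, degreeProj_of_mem_ne (map_mem_exteriorPower f hk) h, map_zero]

theorem prod_ofFn_mem_exteriorPower : ∀ (n : ℕ) (k : Fin n → ℕ) (X : Fin n → ExteriorAlgebra ℂ A),
    (∀ i, X i ∈ ⋀[ℂ]^(k i) A) → (List.ofFn X).prod ∈ ⋀[ℂ]^(∑ i, k i) A
  | 0, _, _, _ => by
    rw [List.ofFn_zero, List.prod_nil, Finset.univ_eq_empty, Finset.sum_empty]
    exact SetLike.GradedOne.one_mem (A := fun i : ℕ => ⋀[ℂ]^i A)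
  | n + 1, k, X, h => by
    rw [List.ofFn_succ, List.prod_cons, Fin.sum_univ_succ]
    exact SetLike.GradedMul.mul_mem (A := fun i : ℕ => ⋀[ℂ]^i A) (h 0)
      (prod_ofFn_mem_exteriorPower n _ _ fun i => h i.succ)

end ExteriorGrading

/-! ### The grading of the tensor products and of the induced modules. -/

section Grading

variable {V : Type*} [Fintype V] (num : BlockNumbering V)

theorem wedge_mem_of_mem_WGr (π : Setoid V) {j : ℕ} {w : W π} (hw : w ∈ WGr π j) :
    wedge num π w ∈ ⋀[ℂ]^j (T π) := by
  refine (Submodule.span_le (p := (⋀[ℂ]^j (T π)).comap (wedge num π))).2 ?_ hw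
  rintro _ ⟨k, x, hx, rfl, rfl⟩
  change wedge num π _ ∈ ⋀[ℂ]^(∑ᶠ q, k q) (T π)
  -- The total degree is summed along the numbering, to match the ordered product.
  rw [wedge_tprod, ← finsum_comp_equiv (num π), finsum_eq_sum_of_fintype]
  exact prod_ofFn_mem_exteriorPower _ _ _ fun i => map_mem_exteriorPower _ (hx _)

/-- Pure tensors span; splitting each factor into homogeneous components and expanding multilinearly
leaves homogeneous pure tensors. -/
theorem iSup_WGr (π : Setoid V) : ⨆ j, WGr π j = ⊤ := by
  classical
  have : Fintype (Quotient π) := Fintype.ofFinite _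
  rw [eq_top_iff, ← PiTensorProduct.span_tprod_eq_top, Submodule.span_le]
  rintro _ ⟨x, rfl⟩
  choose s hs using fun q => exists_sum_degreeProj (x q)
  have h : x = fun q => ∑ k ∈ s q, degreeProj _ k (x q) :=
    funext fun q => (hs q _ subset_rfl).symm
  rw [h, MultilinearMap.map_sum_finset]
  refine Submodule.sum_mem _ fun k _ => Submodule.mem_iSup_of_mem (∑ᶠ q, k q) ?_
  exact Submodule.subset_span ⟨k, _, fun q => degreeProj_mem _ _, rfl, rfl⟩

/-- For the converse, write `w` as a sum of homogeneous elements `f k`. The image of `w` has degree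
`j`, so it equals the image of `f j` alone, and injectivity of `wedge` gives `w = f j`. -/
theorem mem_WGr_iff (π : Setoid V) {j : ℕ} {w : W π} :
    w ∈ WGr π j ↔ wedge num π w ∈ ⋀[ℂ]^j (T π) := by
  refine ⟨wedge_mem_of_mem_WGr num π, fun h => ?_⟩
  obtain ⟨f, hf⟩ := (Submodule.mem_iSup_iff_exists_finsupp (WGr π) w).1
    (iSup_WGr π ▸ Submodule.mem_top)
  have h1 : wedge num π w = wedge num π (f j) := by
    rw [← degreeProj_of_mem h, ← hf.2, Finsupp.sum, map_sum, map_sum]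
    rw [Finset.sum_eq_single j]
    · exact degreeProj_of_mem (wedge_mem_of_mem_WGr num π (hf.1 j))
    · intro k _ hk
      exact degreeProj_of_mem_ne (wedge_mem_of_mem_WGr num π (hf.1 k)) hk
    · intro hj
      rw [Finsupp.notMem_support_iff.1 hj, map_zero, map_zero]
  rw [(wedge_bijective num π).1 h1]
  exact hf.1 j

/-- The projection of `L_{B_1} ⊗ ⋯ ⊗ L_{B_r}` onto its degree `j` part. -/
def WProj (π : Setoid V) (j : ℕ) : Representation.IntertwiningMap (WRep π) (WRep π) where
  toLinearMap := (wedgeEquiv num π).symm.toLinearMap ∘ₗ degreeProj (T π) j ∘ₗ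
    (wedgeEquiv num π).toLinearMap
  isIntertwining' σ := by
    refine LinearMap.ext fun w => ?_
    change (wedgeEquiv num π).symm (degreeProj (T π) j (wedge num π (WRep π σ w))) =
      WRep π σ ((wedgeEquiv num π).symm (degreeProj (T π) j (wedge num π w)))
    rw [LinearEquiv.symm_apply_eq, wedge_WRep, degreeProj_map]
    change _ = wedge num π (WRep π σ _)
    rw [wedge_WRep]
    congr 1
    exact ((wedgeEquiv num π).apply_symm_apply _).symm

theorem wedge_WProj (π : Setoid V) (j : ℕ) (w : W π) :
    wedge num π (WProj num π j w) = degreeProj (T π) j (wedge num π w) :=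
  (wedgeEquiv num π).apply_symm_apply _

/-- The projection of the induced module onto its degree `j` part. -/
def MProj (π : Setoid V) (j : ℕ) : M π →ₗ[ℂ] M π :=
  (Representation.coindMap (young π).subtype (WProj num π j)).toLinearMap

theorem MProj_apply (π : Setoid V) (j : ℕ) (f : M π) (g : Equiv.Perm V) :
    (MProj num π j f).1 g = WProj num π j (f.1 g) := rfl

theorem MProj_mem (π : Setoid V) (j : ℕ) (f : M π) : MProj num π j f ∈ MGr π j := fun g => by
  rw [MProj_apply, mem_WGr_iff num, wedge_WProj]
  exact degreeProj_mem _ _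

theorem MProj_of_mem (π : Setoid V) {j : ℕ} {f : M π} (hf : f ∈ MGr π j) :
    MProj num π j f = f := by
  refine Subtype.ext (funext fun g => (wedge_bijective num π).1 ?_)
  rw [MProj_apply, wedge_WProj, degreeProj_of_mem ((mem_WGr_iff num π).1 (hf g))]

theorem MProj_of_mem_ne (π : Setoid V) {j k : ℕ} {f : M π} (hf : f ∈ MGr π k) (h : k ≠ j) :
    MProj num π j f = 0 := by
  refine Subtype.ext (funext fun g => (wedge_bijective num π).1 ?_)
  rw [MProj_apply, wedge_WProj, degreeProj_of_mem_ne ((mem_WGr_iff num π).1 (hf g)) h]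
  exact (map_zero _).symm

theorem exists_sum_MProj (π : Setoid V) (f : M π) :
    ∃ s : Finset ℕ, ∀ t, s ⊆ t → ∑ j ∈ t, MProj num π j f = f := by
  classical
  choose s hs using fun g => exists_sum_degreeProj (wedge num π (f.1 g))
  -- `Perm V` is finite, so one index set serves all values of `f`.
  refine ⟨Finset.univ.biUnion s, fun t ht => ?_⟩
  refine Subtype.ext (funext fun g => (wedge_bijective num π).1 ?_)
  rw [AddSubmonoidClass.coe_finsetSum, Finset.sum_apply, map_sum]
  simp only [MProj_apply, wedge_WProj]
  exact hs g t ((Finset.subset_biUnion_of_mem s (Finset.mem_univ g)).trans ht)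

end Grading

/-- The `p j` recover the coordinates of a formal sum from its value, whence injectivity; `hsum`
gives surjectivity. -/
theorem isInternal_of_projections {X : Type*} [AddCommMonoid X] [Module ℂ X]
    (N : ℕ → Submodule ℂ X)
    (p : ℕ → X →ₗ[ℂ] X) (hp : ∀ j x, p j x ∈ N j) (hpN : ∀ j, ∀ x ∈ N j, p j x = x)
    (hne : ∀ j k, k ≠ j → ∀ x ∈ N k, p j x = 0)
    (hsum : ∀ x, ∃ s : Finset ℕ, ∑ j ∈ s, p j x = x) : DirectSum.IsInternal N := by
  classical
  have key : ∀ j, ∀ a : ⨁ j, N j, p j (DirectSum.coeLinearMap N a) = a j := by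
    intro j a
    induction a using DirectSum.induction_on with
    | zero => simp
    | of k x =>
      rw [DirectSum.coeLinearMap_of]
      by_cases h : k = j
      · subst h
        rw [DirectSum.of_eq_same, hpN k _ x.2]
      · rw [DirectSum.of_eq_of_ne _ _ _ (Ne.symm h), hne j k h _ x.2]
        rfl
    | add a b ha hb => rw [map_add, map_add, ha, hb, DirectSum.add_apply, Submodule.coe_add]
  refine ⟨fun a b hab => ?_, fun x => ?_⟩
  · refine DFinsupp.ext fun j => Subtype.ext ?_
    rw [← key, ← key]
    exact congrArg (p j) hab
  · obtain ⟨s, hs⟩ := hsum x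
    refine ⟨∑ j ∈ s, DirectSum.of (fun j => N j) j ⟨p j x, hp j x⟩, ?_⟩
    rw [map_sum]
    simpa using hs

/-! ### Functoriality, degree and equivariance of the per-edge maps. -/

section Split

variable {V : Type*} [Fintype V] (num : BlockNumbering V)

theorem wedge_splitMap {π π' : Setoid V} (h : π' ≤ π) (w : W π) :
    wedge num π' (splitMap num h w) = ExteriorAlgebra.map (proj π π') (wedge num π w) :=
  (wedgeEquiv num π').apply_symm_apply _

theorem splitMap_mem_WGr {π π' : Setoid V} (h : π' ≤ π) {j : ℕ} {w : W π} (hw : w ∈ WGr π j) :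
    splitMap num h w ∈ WGr π' j := by
  rw [mem_WGr_iff num, wedge_splitMap]
  exact map_mem_exteriorPower _ ((mem_WGr_iff num π).1 hw)

theorem proj_self (π : Setoid V) : proj π π = LinearMap.id :=
  LinearMap.ext fun x => Submodule.projectionOnto_apply_left (isCompl_T_invariants π) x

/-- The first projection changes `x` by a vector constant on the blocks of `π'`. Such a vector is
constant on the smaller blocks of `π''`, so the second projection kills it. -/
theorem proj_proj {π π' π'' : Setoid V} (h : π'' ≤ π') (x : T π) :
    proj π' π'' (proj π π' x) = proj π π'' x := by
  have hK : (proj π π' x).1 - x.1 ∈ invariants π' := by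
    rw [← Submodule.projectionOnto_apply_eq_zero_iff (isCompl_T_invariants π'), map_sub,
      sub_eq_zero, Submodule.projectionOnto_apply_left]
    rfl
  change (T π'').projectionOnto _ _ _ = (T π'').projectionOnto _ _ _
  rw [← sub_eq_zero, ← map_sub, Submodule.projectionOnto_apply_eq_zero_iff]
  exact fun u v huv => hK u v (h huv)

theorem splitMap_self (π : Setoid V) (h : π ≤ π) (w : W π) : splitMap num h w = w := by
  refine (wedge_bijective num π).1 ?_
  rw [wedge_splitMap, proj_self, ExteriorAlgebra.map_id]
  rfl

theorem splitMap_splitMap {π π' π'' : Setoid V} (h : π' ≤ π) (h' : π'' ≤ π') (w : W π) :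
    splitMap num h' (splitMap num h w) = splitMap num (h'.trans h) w := by
  refine (wedge_bijective num π'').1 ?_
  rw [wedge_splitMap, wedge_splitMap, wedge_splitMap, ← AlgHom.comp_apply,
    ExteriorAlgebra.map_comp_map]
  congr 2
  exact LinearMap.ext (proj_proj h')

/-- The Frobenius correspondent of `splitMap`, evaluated at `1` by transitivity of induction, is
`splitMap` itself. The same formula covers equal partitions, so later arguments need no case split.
-/
theorem inducedMap_apply {π π' : Setoid V} (h : π' ≤ π) (f : M π) (g : Equiv.Perm V) :
    (inducedMap num h f).1 g = splitMap num h (f.1 g) := by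
  unfold inducedMap
  split_ifs with hπ
  · subst hπ
    exact (splitMap_self num π h _).symm
  · change splitMap num h (WRep π 1 (f.1 g)) = _
    rw [map_one]
    rfl

theorem inducedMap_inducedMap {π π' π'' : Setoid V} (h : π' ≤ π) (h' : π'' ≤ π') (f : M π) :
    inducedMap num h' (inducedMap num h f) = inducedMap num (h'.trans h) f := by
  refine Subtype.ext (funext fun g => ?_)
  simp only [inducedMap_apply, splitMap_splitMap]

theorem inducedMap_mem_MGr {π π' : Setoid V} (h : π' ≤ π) {j : ℕ} {f : M π} (hf : f ∈ MGr π j) :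
    inducedMap num h f ∈ MGr π' j := fun g => by
  rw [inducedMap_apply]
  exact splitMap_mem_WGr num h (hf g)

theorem inducedMap_MRep {π π' : Setoid V} (h : π' ≤ π) (g : Equiv.Perm V) (f : M π) :
    inducedMap num h (MRep π g f) = MRep π' g (inducedMap num h f) := by
  refine Subtype.ext (funext fun g' => ?_)
  change _ = (inducedMap num h f).1 (g' * g)
  rw [inducedMap_apply, inducedMap_apply]
  rfl

end Split

/-! ### The chain modules and the differential. -/

section Complex

variable {V : Type*} [Fintype V] {m : ℕ} (num : BlockNumbering V) (ends : Fin m → Sym2 V)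

/-- The inclusion of the summand `M_F` into the chain module. -/
abbrev chainOf {i : ℕ} (F : State m i) : M (components ends F.1) →ₗ[ℂ] C ends i :=
  DirectSum.lof ℂ (State m i) (fun F' => M (components ends F'.1)) F

theorem components_erase_le {V : Type*} (ends : Fin m → Sym2 V) {i : ℕ} (F : State m (i + 1))
    (e : {e // e ∈ F.1}) : components ends (F.erase e).1 ≤ components ends F.1 :=
  components_mono ends (F.1.erase_subset e.1)

theorem d_chainOf {i : ℕ} (F : State m (i + 1)) (f : M (components ends F.1)) :
    d num ends i (chainOf ends F f) =
      ∑ e : {e // e ∈ F.1}, sgn F.1 e.1 •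
        chainOf ends (F.erase e) (inducedMap num (components_erase_le ends F e) f) := by
  rw [d, DirectSum.toModule_lof, LinearMap.sum_apply]
  exact Finset.sum_congr rfl fun e _ => map_smul (chainOf ends (F.erase e)) _ _

theorem chainOf_mem_CGr {i j : ℕ} (F : State m i) {f : M (components ends F.1)}
    (hf : f ∈ MGr _ j) : chainOf ends F f ∈ CGr ends i j := by
  classical
  intro F'
  by_cases h : F = F'
  · subst h
    rwa [DirectSum.lof_apply]
  · rw [DirectSum.lof_eq_of, DirectSum.of_eq_of_ne _ _ _ (Ne.symm h)]
    exact Submodule.zero_mem _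

theorem sum_chainOf {i : ℕ} (x : C ends i) : ∑ F, chainOf ends F (x F) = x := by
  classical
  exact DirectSum.sum_univ_of x

/-- The projection of the chain module onto its degree `j` part. -/
def CProj (i j : ℕ) : C ends i →ₗ[ℂ] C ends i :=
  DirectSum.lmap fun F : State m i => MProj num (components ends F.1) j

theorem CProj_apply (i j : ℕ) (x : C ends i) (F : State m i) :
    CProj num ends i j x F = MProj num (components ends F.1) j (x F) :=
  DirectSum.lmap_apply _ _ _

theorem exists_sum_CProj {i : ℕ} (x : C ends i) :
    ∃ s : Finset ℕ, ∑ j ∈ s, CProj num ends i j x = x := by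
  classical
  choose s hs using fun F : State m i => exists_sum_MProj num (components ends F.1) (x F)
  refine ⟨Finset.univ.biUnion s, DFinsupp.ext fun F => ?_⟩
  refine (DFinsupp.finsetSum_apply _ _ _).trans ?_
  refine (Finset.sum_congr rfl fun j _ => CProj_apply num ends i j x F).trans ?_
  exact hs F _ (Finset.subset_biUnion_of_mem s (Finset.mem_univ F))

theorem isInternal_CGr (i : ℕ) : DirectSum.IsInternal fun j => CGr ends i j := by
  -- The graded pieces do not involve a numbering; the projections do, and any numbering will do.
  let num : BlockNumbering V := fun π => (Finite.equivFin (Quotient π)).symm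
  refine isInternal_of_projections _ (CProj num ends i) (fun j x F => ?_) (fun j x hx => ?_)
    (fun j k hk x hx => ?_) (exists_sum_CProj num ends)
  · exact (CProj_apply num ends i j x F) ▸ MProj_mem num _ j _
  · exact DFinsupp.ext fun F => (CProj_apply num ends i j x F).trans (MProj_of_mem num _ (hx F))
  · exact DFinsupp.ext fun F =>
      (CProj_apply num ends i j x F).trans (MProj_of_mem_ne num _ (hx F) hk)

theorem CRep_chainOf {i : ℕ} (g : Equiv.Perm V) (F : State m i) (f : M (components ends F.1)) :
    CRep ends i g (chainOf ends F f) = chainOf ends F (MRep _ g f) :=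
  DirectSum.lmap_lof _ _ _

theorem CRep_mem_CGr {i j : ℕ} (g : Equiv.Perm V) {x : C ends i} (hx : x ∈ CGr ends i j) :
    CRep ends i g x ∈ CGr ends i j := by
  intro F
  have h : CRep ends i g x F = MRep _ g (x F) := DirectSum.lmap_apply _ _ _
  rw [h]
  -- Translation only permutes the values, and degree is a condition on each value.
  exact fun g' => hx F (g' * g)

theorem d_mem_CGr {i j : ℕ} {x : C ends (i + 1)} (hx : x ∈ CGr ends (i + 1) j) :
    d num ends i x ∈ CGr ends i j := by
  rw [← sum_chainOf ends x, map_sum]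
  refine Submodule.sum_mem _ fun F _ => ?_
  rw [d_chainOf]
  exact Submodule.sum_mem _ fun e _ => Submodule.smul_mem _ _
    (chainOf_mem_CGr ends _ (inducedMap_mem_MGr num _ (hx F)))

theorem smul_chainOf_inducedMap_MRep {i k : ℕ} (g : Equiv.Perm V) (F : State m k) (G : State m i)
    (h : components ends G.1 ≤ components ends F.1) (c : ℂ) (f : M (components ends F.1)) :
    c • chainOf ends G (inducedMap num h (MRep (components ends F.1) g f)) =
      CRep ends i g (c • chainOf ends G (inducedMap num h f)) := by
  rw [inducedMap_MRep]
  rw [LinearMap.map_smul (CRep ends i g)]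
  rw [CRep_chainOf]

theorem d_CRep_chainOf {i : ℕ} (g : Equiv.Perm V) (F : State m (i + 1))
    (f : M (components ends F.1)) : d num ends i (CRep ends (i + 1) g (chainOf ends F f)) =
      CRep ends i g (d num ends i (chainOf ends F f)) := by
  rw [CRep_chainOf, d_chainOf, d_chainOf]
  exact (Finset.sum_congr rfl fun e _ => smul_chainOf_inducedMap_MRep num ends g F _ _ _ f).trans
    (map_sum (CRep ends i g) _ _).symm

theorem d_CRep (i : ℕ) (g : Equiv.Perm V) (x : C ends (i + 1)) :
    d num ends i (CRep ends (i + 1) g x) = CRep ends i g (d num ends i x) := by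
  have h : d num ends i ∘ₗ CRep ends (i + 1) g = CRep ends i g ∘ₗ d num ends i :=
    DirectSum.linearMap_ext _ fun F => LinearMap.ext fun f => d_CRep_chainOf num ends g F f
  exact LinearMap.congr_fun h x

/-! ### Signs. -/

theorem sgn_erase_of_lt {F : Finset (Fin m)} {a b : Fin m} (h : a < b) :
    sgn (F.erase a) b = sgn F b := by
  unfold sgn
  congr 2
  ext c
  simp only [Finset.mem_filter, Finset.mem_univ, true_and, Finset.mem_erase, not_and]
  refine and_congr_right fun hc => ⟨fun h' => h' (h.trans hc).ne', fun h' _ => h'⟩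

/-- Erasing `b` adds exactly one missing edge after `a`. -/
theorem sgn_erase_of_gt {F : Finset (Fin m)} {a b : Fin m} (h : a < b) (hb : b ∈ F) :
    sgn (F.erase b) a = -sgn F a := by
  unfold sgn
  have : (Finset.univ.filter fun c => a < c ∧ c ∉ F.erase b) =
      insert b (Finset.univ.filter fun c => a < c ∧ c ∉ F) := by
    ext c
    by_cases hc : c = b
    · subst hc
      simp [h]
    · simp [hc]
  rw [this, Finset.card_insert_of_notMem (by simp [hb]), pow_succ, mul_neg_one]

/-- Of the two erasures, only that of the later edge affects the sign of the other, so exactly one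
sign flips. -/
theorem sgn_mul_sgn_erase {F : Finset (Fin m)} {a b : Fin m} (ha : a ∈ F) (hb : b ∈ F)
    (hab : a ≠ b) : sgn F a * sgn (F.erase a) b = -(sgn F b * sgn (F.erase b) a) := by
  rcases hab.lt_or_gt with h | h
  · rw [sgn_erase_of_lt h, sgn_erase_of_gt h hb]
    ring
  · rw [sgn_erase_of_lt h, sgn_erase_of_gt h ha]
    ring

/-! ### The square of the differential. -/

theorem d_smul_chainOf_inducedMap {i : ℕ} {π : Setoid V} (G : State m (i + 1))
    (h : components ends G.1 ≤ π) (c : ℂ) (f : M π) :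
    d num ends i (c • chainOf ends G (inducedMap num h f)) =
      ∑ e : {e // e ∈ G.1}, (c * sgn G.1 e.1) • chainOf ends (G.erase e)
        (inducedMap num ((components_erase_le ends G e).trans h) f) := by
  rw [LinearMap.map_smul (d num ends i), d_chainOf, Finset.smul_sum]
  refine Finset.sum_congr rfl fun e _ => ?_
  rw [smul_smul, inducedMap_inducedMap]

theorem d_d_chainOf {i : ℕ} (F : State m (i + 1 + 1)) (f : M (components ends F.1)) :
    d num ends i (d num ends (i + 1) (chainOf ends F f)) =
      ∑ p : (Σ e : {e // e ∈ F.1}, {e' // e' ∈ (F.erase e).1}),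
        (sgn F.1 p.1.1 * sgn (F.erase p.1).1 p.2.1) • chainOf ends ((F.erase p.1).erase p.2)
          (inducedMap num ((components_erase_le ends (F.erase p.1) p.2).trans
            (components_erase_le ends F p.1)) f) := by
  rw [d_chainOf, Fintype.sum_sigma]
  refine (map_sum (d num ends i) _ _).trans (Finset.sum_congr rfl fun e _ => ?_)
  exact d_smul_chainOf_inducedMap num ends _ _ _ f

/-- The states `F - a - b` and `F - b - a` are equal but not definitionally so, and their summands
are different types. Keeping the equality as a hypothesis on variables lets substitution identify
them. -/
theorem smul_chainOf_add_smul_chainOf {i : ℕ} {π : Setoid V} {G G' : State m i} (hG : G = G')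
    {a b : ℂ} (hab : a = -b) (h : components ends G.1 ≤ π) (h' : components ends G'.1 ≤ π)
    (f : M π) :
    a • chainOf ends G (inducedMap num h f) + b • chainOf ends G' (inducedMap num h' f) = 0 := by
  subst hG
  rw [← add_smul, hab, neg_add_cancel, zero_smul]

theorem d_d_chainOf_eq_zero {i : ℕ} (F : State m (i + 1 + 1)) (f : M (components ends F.1)) :
    d num ends i (d num ends (i + 1) (chainOf ends F f)) = 0 := by
  rw [d_d_chainOf]
  -- The involution swaps the two removed edges; it has no fixed point because they are distinct.
  refine Finset.sum_involution (fun p _ => ⟨⟨p.2.1, Finset.mem_of_mem_erase p.2.2⟩,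
    ⟨p.1.1, Finset.mem_erase.2 ⟨(Finset.ne_of_mem_erase p.2.2).symm, p.1.2⟩⟩⟩) ?_ ?_
    (fun _ _ => Finset.mem_univ _) (fun _ _ => rfl)
  · rintro ⟨⟨a, ha⟩, b, hb⟩ -
    exact smul_chainOf_add_smul_chainOf num ends (Subtype.ext Finset.erase_right_comm)
      (sgn_mul_sgn_erase ha (Finset.mem_of_mem_erase hb) (Finset.ne_of_mem_erase hb).symm) _ _ f
  · rintro ⟨⟨a, ha⟩, b, hb⟩ - _ h
    exact Finset.ne_of_mem_erase hb (congrArg (fun p => p.1.1) h)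

theorem d_comp_d (i : ℕ) : d num ends i ∘ₗ d num ends (i + 1) = 0 :=
  DirectSum.linearMap_ext _ fun F => LinearMap.ext fun f => d_d_chainOf_eq_zero num ends F f

end Complex

end ChromaticHomology

end

open ChromaticHomology in
theorem proposition2p5 {V : Type*} [Fintype V] {m : ℕ} (ends : Fin m → Sym2 V)
    (num : BlockNumbering V) :
    (∀ i, DirectSum.IsInternal fun j => CGr ends i j) ∧
    (∀ i j (g : Equiv.Perm V), ∀ x ∈ CGr ends i j, CRep ends i g x ∈ CGr ends i j) ∧
    (∀ i j, ∀ x ∈ CGr ends (i + 1) j, d num ends i x ∈ CGr ends i j) ∧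
    (∀ i (g : Equiv.Perm V) (x : C ends (i + 1)),
      d num ends i (CRep ends (i + 1) g x) = CRep ends i g (d num ends i x)) ∧
    (∀ i, d num ends i ∘ₗ d num ends (i + 1) = 0) :=
  ⟨isInternal_CGr ends, fun _ _ g _ => CRep_mem_CGr ends g, fun _ _ _ => d_mem_CGr num ends,
    d_CRep num ends, d_comp_d num ends⟩
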